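/- **Theorem 1.4.** Let $G$ be a discrete group with identity element $e$, and let $\mathbb L : G \to [0,\infty)$ be a length function, that is, $\mathbb L(xy)\le \mathbb L(x)+\mathbb L(y)$ and $\mathbb L(x^{-1})=\mathbb L(x)$ for all $x,y\in G$, and $\mathbb L(x)=0$ if and only if $x=e$. Put $B(r)=\{x\in G:\mathbb L(x)\le r\}$ and assume that $\mathbb L$ has bounded doubling: $B(r)$ is finite for every $r<\infty$, and there is a constant $C<\infty$ such that $|B(2r)|\le C\,|B(r)|$ for all $r\ge 1$. Let $c_c=C_c(G)$ be the convolution $*$-algebra of finitely supported functions $f:G\to\mathbb C$, with $f^*(x)=\overline{f(x^{-1})}$, let $\lambda_f$ be the operator $(\lambda_f\xi)(x)=\sum_{y\in G} f(xy^{-1})\xi(y)$ on $\ell^2(G)$, and let $D=M_{\mathbb L}$ be the (in general unbounded) operator of pointwise multiplication by $\mathbb L$ on $\ell^2(G)$, with its maximal domain. For every $f\in c_c$ the commutator $[D,\lambda_f]$ extends to a bounded operator on $\ell^2(G)$; put $L_D(f)=\|[D,\lambda_f]\|$ (operator norm). Then $L_D$ is a Lip-norm on $C^*(G)$. This holds both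 for the reduced group C*-algebra $C^*_r(G)$, the operator-norm closure of $\{\lambda_f : f\in c_c\}$, and for the full group C*-algebra $C^*(G)$, the norm closure of $c_c$ in the universal unitary representation of $G$. Explicitly, if $\bar A$ is either of these unital C*-algebras, then $c_c$ embeds in $\bar A$ as a dense $*$-subalgebra; $L_D$ is a seminorm on $c_c$ with $L_D(f^*)=L_D(f)$ and $L_D(1)=0$; and the topology on the state space $S(\bar A)$ defined by the metric $$\rho_{L_D}(\mu,\nu)=\sup\{|\mu(f)-\nu(f)| : f\in c_c,\ L_D(f)\le 1\}$$ (which a priori takes values in $[0,\infty]$) coincides with the weak-$*$ topology. -/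

import Mathlib

open scoped MonoidAlgebra ENNReal ComplexOrder

noncomputable section

namespace GroupCStar

universe u v w

/-! ### Length functions and growth -/

/-- A length function on a group. -/
structure LengthFunction (G : Type u) [Group G] where
  toFun : G → ℝ
  nonneg' : ∀ x, 0 ≤ toFun x
  mul_le' : ∀ x y, toFun (x * y) ≤ toFun x + toFun y
  inv' : ∀ x, toFun x⁻¹ = toFun x
  eq_zero_iff' : ∀ x, toFun x = 0 ↔ x = 1

instance {G : Type u} [Group G] : CoeFun (LengthFunction G) (fun _ => G → ℝ) :=
  ⟨LengthFunction.toFun⟩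

namespace LengthFunction

variable {G : Type u} [Group G] (𝕃 : LengthFunction G)

/-- The closed ball `B(r)` about the identity element. -/
def ball (r : ℝ) : Set G := {x | 𝕃 x ≤ r}

/-- Every ball is a finite set. -/
def IsProper : Prop := ∀ r : ℝ, (𝕃.ball r).Finite

/-- `𝕃` is proper and `|B(2r)| ≤ C |B(r)|` for all `r ≥ 1`. -/
def BoundedDoubling : Prop :=
  𝕃.IsProper ∧ ∃ C : ℝ, ∀ r : ℝ, 1 ≤ r →
    ((𝕃.ball (2 * r)).ncard : ℝ) ≤ C * ((𝕃.ball r).ncard : ℝ)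

theorem abs_sub_le (g x : G) : |𝕃 (g * x) - 𝕃 x| ≤ 𝕃 g := by
  have h1 := 𝕃.mul_le' g x
  have h2 := 𝕃.mul_le' g⁻¹ (g * x)
  rw [inv_mul_cancel_left, 𝕃.inv'] at h2
  rw [abs_le]
  constructor <;> linarith

end LengthFunction

/-! ### The convolution `*`-algebra `c_c(G)`

`ℂ[G]` is the space of finitely supported functions on `G` with convolution; the involution is
`f*(x) = conj (f (x⁻¹))`. -/

section Star

variable {G : Type u} [Group G]

instance : Star ℂ[G] where
  star f := .ofCoeff ((f.coeff.mapRange star (star_zero ℂ)).equivMapDomain (Equiv.inv G))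

theorem coeff_star (f : ℂ[G]) (x : G) : (star f).coeff x = star (f.coeff x⁻¹) := rfl

theorem star_add_aux (f g : ℂ[G]) : star (f + g) = star f + star g := by
  ext x
  simp [coeff_star]

theorem star_single (x : G) (c : ℂ) :
    star (MonoidAlgebra.single x c) = MonoidAlgebra.single x⁻¹ (star c) := by
  ext y
  classical
  have : x = y⁻¹ ↔ x⁻¹ = y := by constructor <;> (rintro rfl; simp)
  simp only [coeff_star, MonoidAlgebra.coeff_single, Finsupp.single_apply, this]
  split_ifs <;> simp

instance : StarRing ℂ[G] where
  star_involutive f := by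
    ext x
    simp [coeff_star]
  star_add := star_add_aux
  star_mul f g := by
    induction f using MonoidAlgebra.induction_linear with
    | zero =>
      have h0 : star (0 : ℂ[G]) = 0 := by ext x; simp [coeff_star]
      simp [h0]
    | add f₁ f₂ h₁ h₂ => rw [add_mul, star_add_aux, h₁, h₂, star_add_aux, mul_add]
    | single x a =>
      induction g using MonoidAlgebra.induction_linear with
      | zero =>
        have h0 : star (0 : ℂ[G]) = 0 := by ext x; simp [coeff_star]
        simp [h0]
      | add f₁ f₂ h₁ h₂ => rw [mul_add, star_add_aux, h₁, h₂, star_add_aux, add_mul]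
      | single y b =>
        simp [star_single, MonoidAlgebra.single_mul_single, mul_comm]

instance : StarModule ℂ ℂ[G] where
  star_smul c f := by
    ext x
    simp [coeff_star]

end Star

/-! ### Group C*-algebras -/

section Representation

variable {G : Type u} [Group G]
variable {H : Type v} [NormedAddCommGroup H] [InnerProductSpace ℂ H] [CompleteSpace H]

/-- The `*`-representation `f ↦ ∑ f(x) π(x)` of `c_c(G)` integrating a unitary representation
`π` of `G` on a Hilbert space. -/
def integrate (π : G →* (H ≃ₗᵢ[ℂ] H)) : ℂ[G] →⋆ₐ[ℂ] (H →L[ℂ] H) where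
  __ := MonoidAlgebra.lift ℂ (H →L[ℂ] H) G
    ((unitary (H →L[ℂ] H)).subtype.comp
      ((Unitary.linearIsometryEquiv (𝕜 := ℂ) (H := H)).symm.toMonoidHom.comp π))
  map_star' f := by
    induction f using MonoidAlgebra.induction_linear with
    | zero => simp
    | add f g hf hg =>
      simp only [AlgHom.toRingHom_eq_coe, RingHom.toMonoidHom_eq_coe, OneHom.toFun_eq_coe,
        MonoidHom.toOneHom_coe, MonoidHom.coe_coe, RingHom.coe_coe] at hf hg ⊢
      rw [star_add, map_add, map_add, star_add, hf, hg]
    | single x a =>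
      simp only [AlgHom.toRingHom_eq_coe, RingHom.toMonoidHom_eq_coe, OneHom.toFun_eq_coe,
        MonoidHom.toOneHom_coe, MonoidHom.coe_coe, RingHom.coe_coe]
      rw [star_single, MonoidAlgebra.lift_single, MonoidAlgebra.lift_single, star_smul]
      congr 1
      simp only [MonoidHom.comp_apply, map_inv]
      rfl

theorem integrate_single (π : G →* (H ≃ₗᵢ[ℂ] H)) (g : G) (c : ℂ) (ξ : H) :
    integrate π (.single g c) ξ = c • π g ξ := by
  change (MonoidAlgebra.lift ℂ (H →L[ℂ] H) G _ (.single g c)) ξ = _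
  rw [MonoidAlgebra.lift_single]
  rfl

/-- The C*-algebra generated by a unitary representation: the operator-norm closure of the image
of `c_c(G)`. -/
def cstarOf (π : G →* (H ≃ₗᵢ[ℂ] H)) : StarSubalgebra ℂ (H →L[ℂ] H) :=
  (integrate π).range.topologicalClosure

instance (π : G →* (H ≃ₗᵢ[ℂ] H)) : IsClosed (cstarOf π : Set (H →L[ℂ] H)) :=
  StarSubalgebra.isClosed_topologicalClosure _

/-- The canonical `*`-homomorphism from `c_c(G)` to the C*-algebra generated by `π`. -/
def toCstarOf (π : G →* (H ≃ₗᵢ[ℂ] H)) : ℂ[G] →⋆ₐ[ℂ] cstarOf π :=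
  (integrate π).codRestrict (cstarOf π) fun f =>
    StarSubalgebra.le_topologicalClosure _ ⟨f, rfl⟩

end Representation

/-! ### The reduced group C*-algebra -/

section Reduced

/-- The Hilbert space `ℓ²(G)`. -/
abbrev Ell2 (G : Type u) : Type u := lp (fun _ : G => ℂ) 2

variable {G : Type u} [Group G]

theorem memℓp_translate (g : G) (ξ : Ell2 G) : Memℓp (fun x => ξ (g⁻¹ * x)) 2 := by
  have h2 : 0 < (2 : ℝ≥0∞).toReal := by simp
  refine memℓp_gen ?_
  exact (Equiv.mulLeft g⁻¹).summable_iff.mpr (ξ.2.summable h2)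

/-- Left translation `(λ_g ξ)(x) = ξ(g⁻¹ x)` on `ℓ²(G)`. -/
def leftTranslate (g : G) : Ell2 G ≃ₗᵢ[ℂ] Ell2 G where
  toFun ξ := ⟨fun x => ξ (g⁻¹ * x), memℓp_translate g ξ⟩
  invFun ξ := ⟨fun x => ξ (g⁻¹⁻¹ * x), memℓp_translate g⁻¹ ξ⟩
  map_add' _ _ := rfl
  map_smul' _ _ := rfl
  left_inv ξ := by ext x; simp
  right_inv ξ := by ext x; simp
  norm_map' ξ := by
    have h2 : 0 < (2 : ℝ≥0∞).toReal := by simp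
    rw [lp.norm_eq_tsum_rpow h2, lp.norm_eq_tsum_rpow h2]
    congr 1
    exact (Equiv.mulLeft g⁻¹).tsum_eq (fun x => ‖ξ x‖ ^ (2 : ℝ≥0∞).toReal)

@[simp]
theorem leftTranslate_apply (g : G) (ξ : Ell2 G) (x : G) :
    leftTranslate g ξ x = ξ (g⁻¹ * x) := rfl

variable (G) in
/-- The left regular representation of `G` on `ℓ²(G)`. -/
def leftRegular : G →* (Ell2 G ≃ₗᵢ[ℂ] Ell2 G) where
  toFun := leftTranslate
  map_one' := by ext ξ x; simp
  map_mul' g h := by ext ξ x; simp [mul_assoc]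

/-- `λ_f`, the operator on `ℓ²(G)` of left convolution by `f ∈ c_c(G)`. -/
abbrev lconv (f : ℂ[G]) : Ell2 G →L[ℂ] Ell2 G := integrate (leftRegular G) f

theorem lconv_apply (f : ℂ[G]) (ξ : Ell2 G) (x : G) :
    lconv f ξ x = f.coeff.sum fun y c => c * ξ (y⁻¹ * x) := by
  induction f using MonoidAlgebra.induction_linear with
  | zero => simp
  | add f g hf hg =>
    rw [MonoidAlgebra.coeff_add, Finsupp.sum_add_index' (by simp) (by intros; ring), ← hf, ← hg]
    have : lconv (f + g) ξ = lconv f ξ + lconv g ξ := by rw [lconv, map_add]; rfl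
    rw [this]
    rfl
  | single y c =>
    rw [MonoidAlgebra.coeff_single, Finsupp.sum_single_index (by simp), lconv, integrate_single]
    rfl

variable (G) in
/-- The reduced group C*-algebra `C*_r(G)`. -/
abbrev ReducedCStar : StarSubalgebra ℂ (Ell2 G →L[ℂ] Ell2 G) := cstarOf (leftRegular G)

end Reduced

/-! ### The full group C*-algebra -/

section Full

/-- A unitary representation of `G` on a Hilbert space. -/
structure UnitaryRep (G : Type u) [Group G] : Type (u + 1) where
  H : Type u
  [normed : NormedAddCommGroup H]
  [inner : InnerProductSpace ℂ H]
  [complete : CompleteSpace H]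
  rep : G →* (H ≃ₗᵢ[ℂ] H)

attribute [instance] UnitaryRep.normed UnitaryRep.inner UnitaryRep.complete

variable (G : Type u) [Group G]

/-- The Hilbert space direct sum of all unitary representations of `G`. (Every cyclic unitary
representation of `G` is equivalent to one on a Hilbert space in the universe of `G`.) -/
abbrev UniversalSpace : Type (u + 1) := lp (fun π : UnitaryRep.{u} G => π.H) 2

variable {G}

theorem memℓp_universal (g : G) (ξ : UniversalSpace G) :
    Memℓp (fun π : UnitaryRep.{u} G => π.rep g (ξ π)) 2 := by
  have h2 : 0 < (2 : ℝ≥0∞).toReal := by simp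
  refine memℓp_gen ?_
  simpa only [LinearIsometryEquiv.norm_map] using ξ.2.summable h2

/-- The action of a group element in the universal representation. -/
def universalAct (g : G) : UniversalSpace G ≃ₗᵢ[ℂ] UniversalSpace G where
  toFun ξ := ⟨fun π => π.rep g (ξ π), memℓp_universal g ξ⟩
  invFun ξ := ⟨fun π => π.rep g⁻¹ (ξ π), memℓp_universal g⁻¹ ξ⟩
  map_add' ξ η := by ext π; exact map_add (π.rep g) (ξ π) (η π)
  map_smul' c ξ := by ext π; simp
  left_inv ξ := by ext π; simp
  right_inv ξ := by ext π; simp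
  norm_map' ξ := by
    have h2 : 0 < (2 : ℝ≥0∞).toReal := by simp
    rw [lp.norm_eq_tsum_rpow h2, lp.norm_eq_tsum_rpow h2]
    simp

@[simp]
theorem universalAct_apply (g : G) (ξ : UniversalSpace G) (π : UnitaryRep.{u} G) :
    universalAct g ξ π = π.rep g (ξ π) := rfl

variable (G)

/-- The universal representation of `G`, the direct sum of all unitary representations. -/
def universalRep : G →* (UniversalSpace G ≃ₗᵢ[ℂ] UniversalSpace G) where
  toFun := universalAct
  map_one' := by ext ξ π; simp
  map_mul' g h := by ext ξ π; simp

/-- The full group C*-algebra `C*(G)`, the closure of `c_c(G)` in the universal representation. -/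
abbrev FullCStar : StarSubalgebra ℂ (UniversalSpace G →L[ℂ] UniversalSpace G) :=
  cstarOf (universalRep G)

end Full

/-! ### The Dirac operator and the seminorm `L_D` -/

section Dirac

/-- `T` is a bounded, everywhere defined extension of the commutator `[D, a]` of an unbounded
operator `D` and a bounded operator `a`: the operator `a` preserves the domain of
`D`, and `T ξ = D (a ξ) - a (D ξ)` for all `ξ` in that domain. -/
def IsCommutator {H : Type v} [NormedAddCommGroup H] [NormedSpace ℂ H]
    (D : H →ₗ.[ℂ] H) (a T : H →L[ℂ] H) : Prop :=
  ∀ ξ : D.domain, ∃ h : a ξ ∈ D.domain, T ξ = D ⟨a ξ, h⟩ - a (D ξ)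

variable {G : Type u}

/-- The self-adjoint operator `M_h` on `ℓ²(G)` of pointwise multiplication by a real function `h`,
with domain `{ξ ∈ ℓ²(G) : h ξ ∈ ℓ²(G)}`. -/
def mulOp (h : G → ℝ) : Ell2 G →ₗ.[ℂ] Ell2 G where
  domain :=
    { carrier := {ξ | Memℓp (fun x => (h x : ℂ) * ξ x) 2}
      add_mem' := by
        intro ξ η hξ hη
        have := hξ.add hη
        refine (congrArg (Memℓp · 2) ?_).mp this
        funext x
        simp [mul_add]
      zero_mem' := by
        refine (congrArg (Memℓp · 2) ?_).mp (zero_memℓp (E := fun _ : G => ℂ))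
        funext x
        simp
      smul_mem' := by
        intro c ξ hξ
        have := hξ.const_smul c
        refine (congrArg (Memℓp · 2) ?_).mp this
        funext x
        simp [mul_left_comm] }
  toFun :=
    { toFun := fun ξ => ⟨fun x => (h x : ℂ) * (ξ : Ell2 G) x, ξ.2⟩
      map_add' := by
        intro ξ η
        ext x
        exact mul_add (h x : ℂ) ((ξ : Ell2 G) x) ((η : Ell2 G) x)
      map_smul' := by
        intro c ξ
        ext x
        simp [mul_left_comm] }

theorem mem_mulOp_domain (h : G → ℝ) (ξ : Ell2 G) :
    ξ ∈ (mulOp h).domain ↔ Memℓp (fun x => (h x : ℂ) * ξ x) 2 := Iff.rfl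

@[simp]
theorem mulOp_apply (h : G → ℝ) (ξ : (mulOp h).domain) (x : G) :
    mulOp h ξ x = (h x : ℂ) * (ξ : Ell2 G) x := rfl

theorem dense_mulOp_domain (h : G → ℝ) : Dense ((mulOp h).domain : Set (Ell2 G)) := by
  classical
  intro ξ
  have hs := lp.hasSum_single (by simp : (2 : ℝ≥0∞) ≠ ⊤) ξ
  refine mem_closure_of_tendsto hs (Filter.Eventually.of_forall fun s => ?_)
  refine Submodule.sum_mem _ fun i _ => ?_
  rw [mem_mulOp_domain]
  refine (congrArg (Memℓp · 2) ?_).mp (lp.single 2 i ((h i : ℂ) * ξ i)).2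
  funext x
  by_cases hx : x = i
  · subst hx; simp
  · simp [hx]

theorem memℓp_bounded_mul {m : G → ℝ} {C : ℝ} (hm : ∀ x, |m x| ≤ C) (ξ : Ell2 G) :
    Memℓp (fun x => (m x : ℂ) * ξ x) 2 := by
  have h2 : 0 < (2 : ℝ≥0∞).toReal := by simp
  refine memℓp_gen (Summable.of_nonneg_of_le (fun x => by positivity) (fun x => ?_)
    (((lp.memℓp ξ).summable h2).mul_left (|C| ^ (2 : ℝ≥0∞).toReal)))
  rw [← Real.mul_rpow (abs_nonneg _) (norm_nonneg _)]
  refine Real.rpow_le_rpow (norm_nonneg _) ?_ h2.le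
  rw [norm_mul, Complex.norm_real, Real.norm_eq_abs]
  exact mul_le_mul_of_nonneg_right ((hm x).trans (le_abs_self C)) (norm_nonneg _)

variable [Group G]

/-- The Dirac operator `D = M_𝕃`. -/
abbrev dirac (𝕃 : LengthFunction G) : Ell2 G →ₗ.[ℂ] Ell2 G := mulOp 𝕃

section Uniqueness

variable {H : Type v} [NormedAddCommGroup H] [NormedSpace ℂ H] {D : H →ₗ.[ℂ] H}
  {a b S T : H →L[ℂ] H}

theorem IsCommutator.unique (hD : Dense (D.domain : Set H)) (hS : IsCommutator D a S)
    (hT : IsCommutator D a T) : S = T := by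
  refine DFunLike.coe_injective (S.continuous.ext_on hD T.continuous fun ξ hξ => ?_)
  obtain ⟨_, h1⟩ := hS ⟨ξ, hξ⟩
  obtain ⟨_, h2⟩ := hT ⟨ξ, hξ⟩
  exact h1.trans h2.symm

theorem IsCommutator.add (hS : IsCommutator D a S) (hT : IsCommutator D b T) :
    IsCommutator D (a + b) (S + T) := by
  intro ξ
  obtain ⟨h1, e1⟩ := hS ξ
  obtain ⟨h2, e2⟩ := hT ξ
  refine ⟨D.domain.add_mem h1 h2, ?_⟩
  have : D ⟨(a + b) ξ, D.domain.add_mem h1 h2⟩ = D ⟨a ξ, h1⟩ + D ⟨b ξ, h2⟩ := by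
    rw [← LinearPMap.map_add]; rfl
  rw [this, add_apply, add_apply, e1, e2]
  abel

theorem IsCommutator.smul (c : ℂ) (hS : IsCommutator D a S) :
    IsCommutator D (c • a) (c • S) := by
  intro ξ
  obtain ⟨h1, e1⟩ := hS ξ
  refine ⟨D.domain.smul_mem c h1, ?_⟩
  have : D ⟨(c • a) ξ, D.domain.smul_mem c h1⟩ = c • D ⟨a ξ, h1⟩ := by
    rw [← LinearPMap.map_smul]; rfl
  rw [this, smul_apply, smul_apply, e1, smul_sub]

theorem IsCommutator.zero : IsCommutator D 0 0 := by
  intro ξ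
  refine ⟨D.domain.zero_mem, ?_⟩
  have : D ⟨(0 : H →L[ℂ] H) ξ, D.domain.zero_mem⟩ = 0 := by
    rw [← LinearPMap.map_zero D]; rfl
  rw [this]
  simp

end Uniqueness

/-- The commutator `[D, λ_g]` with one translation is bounded. -/
theorem exists_isCommutator_translate (𝕃 : LengthFunction G) (g : G) :
    ∃ T, IsCommutator (dirac 𝕃) (lconv (.single g 1)) T := by
  have hb : ∀ x, |𝕃 x - 𝕃 (g⁻¹ * x)| ≤ 𝕃 g := fun x => by
    simpa using 𝕃.abs_sub_le g (g⁻¹ * x)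
  have hlam : ∀ ξ : Ell2 G, lconv (.single g 1) ξ = leftTranslate g ξ := fun ξ => by
    rw [lconv, integrate_single, one_smul]; rfl
  let T₀ : Ell2 G →ₗ[ℂ] Ell2 G :=
    { toFun := fun ξ => ⟨fun x => ((𝕃 x - 𝕃 (g⁻¹ * x) : ℝ) : ℂ) * leftTranslate g ξ x,
        memℓp_bounded_mul hb _⟩
      map_add' := by intro ξ η; ext x; exact mul_add _ (ξ (g⁻¹ * x)) (η (g⁻¹ * x))
      map_smul' := by intro c ξ; ext x; simp [mul_left_comm] }
  have hT₀ : ∀ ξ x, T₀ ξ x = ((𝕃 x - 𝕃 (g⁻¹ * x) : ℝ) : ℂ) * ξ (g⁻¹ * x) := fun _ _ => rfl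
  have hbound : ∀ ξ, ‖T₀ ξ‖ ≤ 𝕃 g * ‖ξ‖ := by
    intro ξ
    have h2 : 0 < (2 : ℝ≥0∞).toReal := by simp
    have hL := 𝕃.nonneg' g
    rw [← (leftTranslate g).norm_map ξ]
    refine lp.norm_le_of_tsum_le h2 (by positivity) ?_
    rw [Real.mul_rpow hL (norm_nonneg _), lp.norm_rpow_eq_tsum h2, ← tsum_mul_left]
    refine ((lp.memℓp (T₀ ξ)).summable h2).tsum_le_tsum (fun x => ?_)
      (((lp.memℓp (leftTranslate g ξ)).summable h2).mul_left _)
    rw [← Real.mul_rpow hL (norm_nonneg _)]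
    refine Real.rpow_le_rpow (norm_nonneg _) ?_ h2.le
    rw [hT₀, norm_mul, Complex.norm_real, Real.norm_eq_abs]
    exact mul_le_mul_of_nonneg_right (hb x) (norm_nonneg _)
  refine ⟨T₀.mkContinuous (𝕃 g) hbound, fun ξ => ?_⟩
  have hmem : lconv (.single g 1) (ξ : Ell2 G) ∈ (dirac 𝕃).domain := by
    rw [mem_mulOp_domain, hlam]
    have h1 := (lp.memℓp (T₀ ξ)).add (lp.memℓp (leftTranslate g (dirac 𝕃 ξ)))
    refine (congrArg (Memℓp · 2) ?_).mp h1
    funext x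
    simp only [Pi.add_apply, hT₀, leftTranslate_apply, mulOp_apply]
    push_cast
    ring
  refine ⟨hmem, ?_⟩
  ext x
  have e1 : lconv (.single g 1) (ξ : Ell2 G) x = (ξ : Ell2 G) (g⁻¹ * x) := by rw [hlam]; rfl
  have e2 : lconv (.single g 1) (dirac 𝕃 ξ) x = (𝕃 (g⁻¹ * x) : ℂ) * (ξ : Ell2 G) (g⁻¹ * x) := by
    rw [hlam]; rfl
  have e3 : (dirac 𝕃 ⟨_, hmem⟩ - lconv (.single g 1) (dirac 𝕃 ξ) : Ell2 G) x =
      (𝕃 x : ℂ) * lconv (.single g 1) (ξ : Ell2 G) x -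
        lconv (.single g 1) (dirac 𝕃 ξ) x := rfl
  rw [e3, e1, e2]
  refine (hT₀ ξ x).trans ?_
  push_cast
  ring

/-- For `f ∈ c_c(G)` the commutator `[D, λ_f]` extends to a bounded operator. -/
theorem exists_isCommutator (𝕃 : LengthFunction G) (f : ℂ[G]) :
    ∃ T, IsCommutator (dirac 𝕃) (lconv f) T := by
  induction f using MonoidAlgebra.induction_linear with
  | zero => exact ⟨0, by rw [lconv, map_zero]; exact IsCommutator.zero⟩
  | add f g hf hg =>
    obtain ⟨S, hS⟩ := hf
    obtain ⟨T, hT⟩ := hg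
    exact ⟨S + T, by rw [lconv, map_add]; exact hS.add hT⟩
  | single g c =>
    obtain ⟨T, hT⟩ := exists_isCommutator_translate 𝕃 g
    refine ⟨c • T, ?_⟩
    have : lconv (.single g c) = c • lconv (.single g 1) := by
      rw [lconv, lconv, ← map_smul, MonoidAlgebra.smul_single, smul_eq_mul, mul_one]
    rw [this]
    exact hT.smul c

/-- The bounded operator `[D, λ_f]` on `ℓ²(G)`, for `D = M_𝕃`: the unique bounded extension of
the commutator (uniqueness is `commutator_eq`). -/
def commutator (𝕃 : LengthFunction G) (f : ℂ[G]) : Ell2 G →L[ℂ] Ell2 G :=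
  (exists_isCommutator 𝕃 f).choose

theorem isCommutator_commutator (𝕃 : LengthFunction G) (f : ℂ[G]) :
    IsCommutator (dirac 𝕃) (lconv f) (commutator 𝕃 f) :=
  (exists_isCommutator 𝕃 f).choose_spec

theorem commutator_eq (𝕃 : LengthFunction G) {f : ℂ[G]} {T : Ell2 G →L[ℂ] Ell2 G}
    (hT : IsCommutator (dirac 𝕃) (lconv f) T) : commutator 𝕃 f = T :=
  (isCommutator_commutator 𝕃 f).unique (dense_mulOp_domain _) hT

/-- The seminorm `L_D(f) = ‖[D, λ_f]‖` on `c_c(G)`. -/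
def seminormLD (𝕃 : LengthFunction G) : Seminorm ℂ ℂ[G] :=
  Seminorm.of (fun f => ‖commutator 𝕃 f‖)
    (fun f g => by
      have : commutator 𝕃 (f + g) = commutator 𝕃 f + commutator 𝕃 g := commutator_eq 𝕃 (by
        rw [lconv, map_add]
        exact (isCommutator_commutator 𝕃 f).add (isCommutator_commutator 𝕃 g))
      rw [this]
      exact norm_add_le _ _)
    (fun c f => by
      have : commutator 𝕃 (c • f) = c • commutator 𝕃 f := commutator_eq 𝕃 (by
        rw [lconv, map_smul]
        exact (isCommutator_commutator 𝕃 f).smul c)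
      rw [this, norm_smul])

end Dirac

/-! ### States, the Connes metric and Lip-norms -/

section LipNorm

variable (A : Type v) [CStarAlgebra A]

/-- The state space of a unital C*-algebra: the positive linear functionals of value `1` at `1`.
As a subtype of `WeakDual ℂ A` it carries the weak-* topology. -/
def stateSpace : Set (WeakDual ℂ A) :=
  {φ | φ 1 = 1 ∧ ∀ a : A, 0 ≤ φ (star a * a)}

variable {A} {𝒜 : Type w} [Ring 𝒜] [Algebra ℂ 𝒜] [StarRing 𝒜]

/-- The Connes metric `ρ_L(μ, ν) = sup {|μ(a) - ν(a)| : a ∈ 𝒜, L(a) ≤ 1}`, with values in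
`[0, ∞]`, where `𝒜` is regarded as a subalgebra of `A` through `ι`. -/
def connesDist (ι : 𝒜 →⋆ₐ[ℂ] A) (L : Seminorm ℂ 𝒜) (μ ν : stateSpace A) : ℝ≥0∞ :=
  ⨆ (a : 𝒜) (_ : L a ≤ 1), ENNReal.ofReal ‖μ.1 (ι a) - ν.1 (ι a)‖

/-- The state space with the metric `ρ_L`. -/
@[reducible]
def connesMetric (ι : 𝒜 →⋆ₐ[ℂ] A) (L : Seminorm ℂ 𝒜) : PseudoEMetricSpace (stateSpace A) where
  edist := connesDist ι L
  edist_self μ := by simp [connesDist]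
  edist_comm μ ν := by simp only [connesDist, norm_sub_rev]
  edist_triangle μ ν κ := by
    refine iSup₂_le fun a ha => ?_
    refine le_trans ?_ (add_le_add
      (le_iSup₂ (f := fun (a : 𝒜) (_ : L a ≤ 1) => ENNReal.ofReal ‖μ.1 (ι a) - ν.1 (ι a)‖) a ha)
      (le_iSup₂ (f := fun (a : 𝒜) (_ : L a ≤ 1) => ENNReal.ofReal ‖ν.1 (ι a) - κ.1 (ι a)‖) a ha))
    rw [← ENNReal.ofReal_add (norm_nonneg _) (norm_nonneg _)]
    exact ENNReal.ofReal_le_ofReal (norm_sub_le_norm_sub_add_norm_sub _ _ _)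

/-- `L` is a Lip-norm on the unital C*-algebra `A`: `ι` identifies `𝒜` with a dense `*`-subalgebra
of `A`, `L` is a `*`-seminorm on it with `L(1) = 0`, and the topology of the metric `ρ_L` on the
state space of `A` is the weak-* topology. -/
structure IsLipNorm (ι : 𝒜 →⋆ₐ[ℂ] A) (L : Seminorm ℂ 𝒜) : Prop where
  injective : Function.Injective ι
  denseRange : DenseRange ι
  map_star : ∀ a, L (star a) = L a
  map_one : L 1 = 0
  topology_eq :
    (connesMetric ι L).toUniformSpace.toTopologicalSpace =
      (instTopologicalSpaceSubtype : TopologicalSpace (stateSpace A))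

end LipNorm

end GroupCStar

end

noncomputable section

namespace GroupCStar

universe u v w

/-! ### States and the comparison of topologies -/

section Topology

variable {A : Type v} [CStarAlgebra A]

/-! The metric topology is weak-* as soon as, up to a uniform `ε`, finitely many evaluations control
the states on the `L_D`-unit ball (`connesMetric_topology_eq`). So `f` with `L_D(f) ≤ 1` has to be
approximated, in the norm of the representation at hand, by functions supported in one fixed ball.
Their coefficients off the identity are bounded by `1 / 𝕃 z`, and the coefficient at the identity is
invisible to a difference of states.

The approximant is `φf`, with `φ(z)` the proportion of `u ∈ B(R)` that `z` moves into `B(4R)`. Two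
facts bound the error. On the block from `B(R)` to `B(16R) \ B(2R)`, the matrix of `λ_f` is
recovered from that of `[D, λ_f]` at the cost of a factor `1/R` (`formBound_of_commutator`).
Transference (`FormBound.norm_integrate_le`) turns a bound on a block `X × U` into a bound for the
cutoff of `f` in every unitary representation, losing `√(|X|/|U|)`, which doubling keeps bounded.
Dyadic pieces of `f` at scale `2^k` then have norm `O(L_D(f) / 2^k)`, and these sum geometrically
(`norm_integrate_sub_ballCutoff_le`). Since the estimate holds in every unitary representation, the
reduced and the full algebra are treated alike. -/

theorem norm_state_apply_le_of_isSelfAdjoint {φ : WeakDual ℂ A} (hφ : φ ∈ stateSpace A) {a : A}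
    (ha : IsSelfAdjoint a) : ‖φ a‖ ≤ ‖a‖ := by
  let _ := CStarAlgebra.spectralOrder A
  have := CStarAlgebra.spectralOrderedRing A
  have hpos : ∀ b : A, 0 ≤ b → 0 ≤ φ b := fun b hb => by
    obtain ⟨c, rfl⟩ := CStarAlgebra.nonneg_iff_eq_star_mul_self.1 hb
    exact hφ.2 c
  have hone : φ (algebraMap ℝ A ‖a‖) = (‖a‖ : ℂ) := by
    have : algebraMap ℝ A ‖a‖ = (‖a‖ : ℂ) • (1 : A) := by
      rw [Algebra.algebraMap_eq_smul_one]
      exact (Complex.coe_smul _ _).symm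
    rw [this, map_smul, hφ.1, smul_eq_mul, mul_one]
  have h1 := hpos _ (sub_nonneg.2 ha.le_algebraMap_norm_self)
  have h2 := hpos _ (sub_nonneg.2 ha.neg_algebraMap_norm_le_self)
  rw [map_sub, hone] at h1
  rw [sub_neg_eq_add, map_add, hone] at h2
  rw [Complex.nonneg_iff] at h1 h2
  simp only [Complex.sub_re, Complex.add_re, Complex.ofReal_re, Complex.add_im, Complex.ofReal_im,
    add_zero] at h1 h2
  have h3 : φ a = ((φ a).re : ℂ) := Complex.ext rfl h2.2.symm
  rw [h3, Complex.norm_real, Real.norm_eq_abs, abs_le]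
  constructor <;> linarith [h1.1, h2.1]

/-- Splitting into real and imaginary parts loses a harmless factor 2. -/
theorem norm_state_apply_le {φ : WeakDual ℂ A} (hφ : φ ∈ stateSpace A) (a : A) :
    ‖φ a‖ ≤ 2 * ‖a‖ := by
  rw [← realPart_add_I_smul_imaginaryPart a, map_add, map_smul]
  refine (norm_add_le _ _).trans ?_
  rw [norm_smul, Complex.norm_I, one_mul, realPart_add_I_smul_imaginaryPart, two_mul]
  exact add_le_add
    ((norm_state_apply_le_of_isSelfAdjoint hφ (realPart a).2).trans (realPart.norm_le a))
    ((norm_state_apply_le_of_isSelfAdjoint hφ (imaginaryPart a).2).trans (imaginaryPart.norm_le a))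

variable {𝒜 : Type w} [Ring 𝒜] [Algebra ℂ 𝒜] [StarRing 𝒜]

theorem norm_sub_le_of_connesDist_lt (ι : 𝒜 →⋆ₐ[ℂ] A) (L : Seminorm ℂ 𝒜) {μ ν : stateSpace A}
    {δ : ℝ} (hδ : 0 < δ) (h : connesDist ι L μ ν < ENNReal.ofReal δ) (a : 𝒜) :
    ‖μ.1 (ι a) - ν.1 (ι a)‖ ≤ (L a + 1) * δ := by
  have hL : 0 < L a + 1 := by linarith [apply_nonneg L a]
  -- Adding 1 allows the rescaling into the unit ball even when `L a = 0`.
  set c : ℂ := Complex.ofReal (L a + 1)⁻¹ with hc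
  have hcn : ‖c‖ = (L a + 1)⁻¹ := by
    rw [hc, Complex.norm_real, Real.norm_eq_abs, abs_of_pos (inv_pos.2 hL)]
  have h1 : L (c • a) ≤ 1 := by
    rw [map_smul_eq_mul, hcn, inv_mul_le_iff₀ hL]
    linarith
  have h2 := (le_iSup₂ (f := fun (a : 𝒜) (_ : L a ≤ 1) =>
    ENNReal.ofReal ‖μ.1 (ι a) - ν.1 (ι a)‖) (c • a) h1).trans_lt h
  rw [ENNReal.ofReal_lt_ofReal_iff hδ, map_smul, map_smul, map_smul, ← smul_sub, norm_smul, hcn,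
    inv_mul_lt_iff₀ hL] at h2
  exact h2.le

/-- If, up to arbitrarily small errors, the values of states on the `L`-unit ball are controlled by
finitely many evaluations, then the Connes metric induces the weak-* topology. -/
theorem connesMetric_topology_eq (ι : 𝒜 →⋆ₐ[ℂ] A) (L : Seminorm ℂ 𝒜) (hι : DenseRange ι)
    (h : ∀ ε > 0, ∃ (F : Finset 𝒜) (M : ℝ), ∀ a, L a ≤ 1 → ∀ μ ν : stateSpace A,
      ‖μ.1 (ι a) - ν.1 (ι a)‖ ≤ ε + M * ∑ b ∈ F, ‖μ.1 (ι b) - ν.1 (ι b)‖) :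
    (connesMetric ι L).toUniformSpace.toTopologicalSpace =
      (instTopologicalSpaceSubtype : TopologicalSpace (stateSpace A)) := by
  have hbasis := fun μ : stateSpace A =>
    @Metric.nhds_basis_eball (stateSpace A) (connesMetric ι L) μ
  refine le_antisymm ?_ ?_
  · rw [← continuous_id_iff_le, continuous_induced_rng]
    refine @WeakDual.continuous_of_continuous_eval _ _ _ _ _ _ _ _ _ _
      (connesMetric ι L).toUniformSpace.toTopologicalSpace _ fun a => ?_
    rw [@continuous_iff_continuousAt _ _ (connesMetric ι L).toUniformSpace.toTopologicalSpace]
    intro μ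
    refine Metric.tendsto_nhds.2 fun ε hε => ?_
    -- Replacing `a` by `ι b` costs at most `2 * ε / 8` for each of the two states; the metric ball
    -- is chosen so that the value at `b` moves by at most `ε / 4`.
    obtain ⟨b, hb⟩ := hι.exists_dist_lt a (show 0 < ε / 8 by positivity)
    rw [dist_eq_norm] at hb
    have hL : 0 < L b + 1 := by linarith [apply_nonneg L b]
    have hδ : 0 < ε / (4 * (L b + 1)) := by positivity
    refine (hbasis μ).eventually_iff.2 ⟨ENNReal.ofReal (ε / (4 * (L b + 1))),
      ENNReal.ofReal_pos.2 hδ, fun {ν} hν => ?_⟩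
    have h1 := norm_sub_le_of_connesDist_lt ι L hδ hν b
    have h2 : (L b + 1) * (ε / (4 * (L b + 1))) = ε / 4 := by field_simp
    rw [h2] at h1
    have h3 := norm_state_apply_le ν.2 (a - ι b)
    have h4 := norm_state_apply_le μ.2 (a - ι b)
    rw [map_sub] at h3 h4
    change dist (ν.1 a) (μ.1 a) < ε
    rw [dist_eq_norm]
    have h5 : ν.1 a - μ.1 a = (ν.1 a - ν.1 (ι b)) - (μ.1 a - μ.1 (ι b)) +
      (ν.1 (ι b) - μ.1 (ι b)) := by ring
    rw [h5]
    refine ((norm_add_le _ _).trans (add_le_add_left (norm_sub_le _ _) _)).trans_lt ?_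
    linarith
  · refine le_of_nhds_le_nhds fun μ => (hbasis μ).ge_iff.2 fun ε hε => ?_
    obtain ⟨r, hr, hrε⟩ : ∃ r : ℝ, 0 < r ∧ ENNReal.ofReal r < ε := by
      obtain ⟨r, h0, hr⟩ := ENNReal.lt_iff_exists_nnreal_btwn.1 hε
      exact ⟨r, by exact_mod_cast h0, by simpa using hr⟩
    obtain ⟨F, M, hFM⟩ := h (r / 2) (by positivity)
    -- This weak-* continuous function vanishes at `μ`, so it is below `r / 2` on a weak-*
    -- neighbourhood.
    have hcont : Continuous fun ν : stateSpace A => M * ∑ b ∈ F, ‖ν.1 (ι b) - μ.1 (ι b)‖ := by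
      refine continuous_const.mul (continuous_finsetSum _ fun b _ => ?_)
      exact (((WeakDual.eval_continuous (ι b)).comp continuous_subtype_val).sub
        continuous_const).norm
    have hev := hcont.tendsto μ
    simp only [sub_self, norm_zero, Finset.sum_const_zero, mul_zero] at hev
    filter_upwards [hev.eventually_lt_const (show 0 < r / 2 by positivity)] with ν hν
    refine lt_of_le_of_lt (iSup₂_le fun a ha => ?_) hrε
    refine ENNReal.ofReal_le_ofReal ?_
    linarith [hFM a ha ν μ]

end Topology

/-! ### Sesquilinear forms with a given kernel -/

section FormBound

variable {G : Type u}

/-- The sesquilinear form with kernel `m`, on vectors supported in `U` and in `X`, is bounded by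
`K`. -/
def FormBound (m : G → G → ℂ) (X U : Finset G) (K : ℝ) : Prop :=
  ∀ ξ η : G → ℂ, ‖∑ x ∈ X, ∑ u ∈ U, m x u * (starRingEnd ℂ (η x) * ξ u)‖ ≤
    K * (√(∑ u ∈ U, ‖ξ u‖ ^ 2) * √(∑ x ∈ X, ‖η x‖ ^ 2))

/-- The form is `⟨η, T ξ⟩` for finitely supported `ξ` and `η`, so Cauchy–Schwarz applies. -/
theorem formBound_of_hasMatrix [DecidableEq G] {m : G → G → ℂ} {T : Ell2 G →L[ℂ] Ell2 G}
    (hT : ∀ x u, T (lp.single 2 u 1) x = m x u) (X U : Finset G) : FormBound m X U ‖T‖ := by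
  intro ξ η
  have hnorm : ∀ (s : Finset G) (ζ : G → ℂ),
      ‖∑ i ∈ s, (lp.single 2 i (ζ i) : Ell2 G)‖ = √(∑ i ∈ s, ‖ζ i‖ ^ 2) := fun s ζ => by
    have := lp.norm_sum_single (p := 2) (E := fun _ : G => ℂ) (by simp) ζ s
    simp only [ENNReal.toReal_ofNat, Real.rpow_ofNat] at this
    rw [← this, Real.sqrt_sq (norm_nonneg _)]
  have hTs : ∀ x u (c : ℂ), T (lp.single 2 u c) x = m x u * c := fun x u c => by
    have : (lp.single 2 u c : Ell2 G) = c • lp.single 2 u 1 := by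
      rw [← lp.single_smul, smul_eq_mul, mul_one]
    rw [this, map_smul, lp.coeFn_smul, Pi.smul_apply, hT, smul_eq_mul, mul_comm]
  have hform : ∑ x ∈ X, ∑ u ∈ U, m x u * (starRingEnd ℂ (η x) * ξ u) =
      inner ℂ (∑ x ∈ X, (lp.single 2 x (η x) : Ell2 G))
        (T (∑ u ∈ U, (lp.single 2 u (ξ u) : Ell2 G))) := by
    rw [map_sum, sum_inner]
    refine Finset.sum_congr rfl fun x _ => ?_
    rw [inner_sum]
    refine Finset.sum_congr rfl fun u _ => ?_
    rw [lp.inner_single_left, hTs, RCLike.inner_apply]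
    ring
  rw [hform, ← hnorm, ← hnorm]
  refine (norm_inner_le_norm _ _).trans ?_
  rw [mul_comm, ← mul_assoc]
  exact mul_le_mul_of_nonneg_right (T.le_opNorm _) (norm_nonneg _)

variable {m : G → G → ℂ} {X U : Finset G} {K : ℝ}

/-- The bound of a form also holds for vectors with entries in a Hilbert space. -/
theorem FormBound.inner_le (h : FormBound m X U K) (hK : 0 ≤ K)
    {H : Type v} [NormedAddCommGroup H] [InnerProductSpace ℂ H] (ξ η : G → H) :
    ‖∑ x ∈ X, ∑ u ∈ U, m x u * inner ℂ (η x) (ξ u)‖ ≤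
      K * (√(∑ u ∈ U, ‖ξ u‖ ^ 2) * √(∑ x ∈ X, ‖η x‖ ^ 2)) := by
  classical
  -- Only finitely many vectors occur. In an orthonormal basis of their span the form is a sum of
  -- scalar forms, one per coordinate, and Cauchy–Schwarz over the coordinates recombines the bounds
  -- without loss.
  let S : Finset H := U.image ξ ∪ X.image η
  let V : Submodule ℂ H := Submodule.span ℂ (S : Set H)
  have : FiniteDimensional ℂ V := FiniteDimensional.span_finset ℂ S
  let b := stdOrthonormalBasis ℂ V
  let P : H → V := fun v => if hv : v ∈ V then ⟨v, hv⟩ else 0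
  have hP : ∀ v ∈ V, ((P v : V) : H) = v := fun v hv => by simp [P, hv]
  have hξ : ∀ u ∈ U, ξ u ∈ V := fun u hu => Submodule.subset_span <| by
    simp only [S, Finset.coe_union, Finset.coe_image]
    exact Or.inl ⟨u, hu, rfl⟩
  have hη : ∀ x ∈ X, η x ∈ V := fun x hx => Submodule.subset_span <| by
    simp only [S, Finset.coe_union, Finset.coe_image]
    exact Or.inr ⟨x, hx, rfl⟩
  have hsq : ∀ (s : Finset G) (ζ : G → H), (∀ i ∈ s, ζ i ∈ V) →
      ∑ j, √(∑ i ∈ s, ‖inner ℂ (b j) (P (ζ i))‖ ^ 2) ^ 2 = ∑ i ∈ s, ‖ζ i‖ ^ 2 := by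
    intro s ζ hζ
    have : ∀ j, √(∑ i ∈ s, ‖inner ℂ (b j) (P (ζ i))‖ ^ 2) ^ 2 =
        ∑ i ∈ s, ‖inner ℂ (b j) (P (ζ i))‖ ^ 2 := fun j =>
      Real.sq_sqrt (Finset.sum_nonneg fun i _ => by positivity)
    simp_rw [this]
    rw [Finset.sum_comm]
    refine Finset.sum_congr rfl fun i hi => ?_
    rw [b.sum_sq_norm_inner_right, Submodule.coe_norm, hP _ (hζ i hi)]
  have hsum : ∑ x ∈ X, ∑ u ∈ U, m x u * inner ℂ (η x) (ξ u) =
      ∑ j, ∑ x ∈ X, ∑ u ∈ U, m x u *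
        (starRingEnd ℂ (inner ℂ (b j) (P (η x))) * inner ℂ (b j) (P (ξ u))) := by
    symm
    rw [Finset.sum_comm]
    refine Finset.sum_congr rfl fun x hx => ?_
    rw [Finset.sum_comm]
    refine Finset.sum_congr rfl fun u hu => ?_
    rw [← Finset.mul_sum]
    congr 1
    simp_rw [inner_conj_symm]
    rw [b.sum_inner_mul_inner, Submodule.coe_inner, hP _ (hη x hx), hP _ (hξ u hu)]
  rw [hsum]
  refine (norm_sum_le _ _).trans ((Finset.sum_le_sum fun j _ =>
    h (fun u => inner ℂ (b j) (P (ξ u))) fun x => inner ℂ (b j) (P (η x))).trans ?_)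
  rw [← Finset.mul_sum]
  refine mul_le_mul_of_nonneg_left ?_ hK
  refine (Real.sum_mul_le_sqrt_mul_sqrt _ _ _).trans ?_
  rw [hsq U ξ hξ, hsq X η hη]

/-- If `L` takes values at most `R` on `U` and at least `2R` on `X`, then the kernel `m` is
controlled by the commutator kernel `(L x - L u) m x u`. -/
theorem formBound_of_commutator {L : G → ℝ} {R K₀ : ℝ} (hR : 0 < R)
    (hL : ∀ u ∈ U, 0 ≤ L u) (hU : ∀ u ∈ U, L u ≤ R) (hX : ∀ x ∈ X, 2 * R ≤ L x)
    (hK : 0 ≤ K) (hK₀ : 0 ≤ K₀)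
    (h₀ : FormBound m X U K₀) (h : FormBound (fun x u => ((L x - L u : ℝ) : ℂ) * m x u) X U K) :
    FormBound m X U (K / R) := by
  -- Write `m = (L x)⁻¹ (L x - L u) m + (L x)⁻¹ m (L u)`. Since `L x ≥ 2R` and `L u ≤ R`, the second
  -- term has at most half the bound of `m`.
  have step : ∀ K', 0 ≤ K' → FormBound m X U K' → FormBound m X U (K / (2 * R) + K' / 2) := by
    intro K' hK' hm ξ η
    have hη : √(∑ x ∈ X, ‖((L x)⁻¹ : ℂ) * η x‖ ^ 2) ≤ (2 * R)⁻¹ * √(∑ x ∈ X, ‖η x‖ ^ 2) := by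
      rw [← Real.sqrt_sq (show 0 ≤ (2 * R)⁻¹ by positivity), ← Real.sqrt_mul (by positivity),
        Finset.mul_sum]
      refine Real.sqrt_le_sqrt (Finset.sum_le_sum fun x hx => ?_)
      have hx' := hX x hx
      have hx0 : 0 < L x := by linarith
      rw [← mul_pow, norm_mul, norm_inv, Complex.norm_real, Real.norm_eq_abs, abs_of_pos hx0]
      gcongr
    have hξ : √(∑ u ∈ U, ‖(L u : ℂ) * ξ u‖ ^ 2) ≤ R * √(∑ u ∈ U, ‖ξ u‖ ^ 2) := by
      rw [← Real.sqrt_sq hR.le, ← Real.sqrt_mul (by positivity), Finset.mul_sum]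
      refine Real.sqrt_le_sqrt (Finset.sum_le_sum fun u hu => ?_)
      rw [← mul_pow, norm_mul, Complex.norm_real, Real.norm_eq_abs, abs_of_nonneg (hL u hu)]
      have := hU u hu
      have := hL u hu
      gcongr
    have e : ∑ x ∈ X, ∑ u ∈ U, m x u * (starRingEnd ℂ (η x) * ξ u) =
        ∑ x ∈ X, ∑ u ∈ U, ((L x - L u : ℝ) : ℂ) * m x u *
            (starRingEnd ℂ (((L x)⁻¹ : ℂ) * η x) * ξ u) +
          ∑ x ∈ X, ∑ u ∈ U, m x u *
            (starRingEnd ℂ (((L x)⁻¹ : ℂ) * η x) * ((L u : ℂ) * ξ u)) := by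
      simp_rw [← Finset.sum_add_distrib]
      refine Finset.sum_congr rfl fun x hx => Finset.sum_congr rfl fun u hu => ?_
      have hx' : (L x : ℂ) ≠ 0 := by
        have := hX x hx
        exact_mod_cast (show 0 < L x by linarith).ne'
      simp only [map_mul, map_inv₀, Complex.conj_ofReal]
      push_cast
      field_simp
      ring
    rw [e]
    have h1 := h ξ fun x => ((L x)⁻¹ : ℂ) * η x
    have h2 := hm (fun u => (L u : ℂ) * ξ u) fun x => ((L x)⁻¹ : ℂ) * η x
    set a := √(∑ u ∈ U, ‖ξ u‖ ^ 2) with ha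
    set b := √(∑ x ∈ X, ‖η x‖ ^ 2) with hb
    have ha0 : 0 ≤ a := Real.sqrt_nonneg _
    have hb0 : 0 ≤ b := Real.sqrt_nonneg _
    refine (norm_add_le _ _).trans ((add_le_add h1 h2).trans ?_)
    calc _ ≤ K * (a * ((2 * R)⁻¹ * b)) + K' * ((R * a) * ((2 * R)⁻¹ * b)) := by gcongr
      _ = (K / (2 * R) + K' / 2) * (a * b) := by field_simp
  -- The map `K' ↦ K / (2R) + K' / 2` has fixed point `K / R` and halves distances; the finite bound
  -- `K₀` starts the iteration.
  have iter : ∀ n : ℕ, FormBound m X U (K / R + K₀ * (1 / 2) ^ n) := by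
    intro n
    induction n with
    | zero =>
      intro ξ η
      refine (h₀ ξ η).trans (mul_le_mul_of_nonneg_right ?_ (by positivity))
      have : 0 ≤ K / R := by positivity
      simpa using this
    | succ n ih =>
      have := step _ (by positivity) ih
      convert this using 1
      rw [pow_succ]
      field_simp
      ring
  intro ξ η
  refine ge_of_tendsto' (f := fun n : ℕ => (K / R + K₀ * (1 / 2) ^ n) *
    (√(∑ u ∈ U, ‖ξ u‖ ^ 2) * √(∑ x ∈ X, ‖η x‖ ^ 2))) (x := Filter.atTop) ?_ fun n => iter n ξ η
  refine Filter.Tendsto.mul_const _ ?_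
  have := ((tendsto_pow_atTop_nhds_zero_of_lt_one (r := (1 / 2 : ℝ)) (by norm_num)
    (by norm_num)).const_mul K₀).const_add (K / R)
  simpa using this

end FormBound

/-! ### Cutoffs of finitely supported functions -/

section Cutoff

variable {G : Type u}

/-- The pointwise product of a function on `G` and an element of `c_c(G)`. -/
def pointwiseMul (φ : G → ℂ) (f : ℂ[G]) : ℂ[G] :=
  .ofCoeff (Finsupp.onFinset f.coeff.support (fun z => φ z * f.coeff z) fun _ hz =>
    Finsupp.mem_support_iff.2 (right_ne_zero_of_mul hz))

@[simp]
theorem coeff_pointwiseMul (φ : G → ℂ) (f : ℂ[G]) (z : G) :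
    (pointwiseMul φ f).coeff z = φ z * f.coeff z := rfl

theorem pointwiseMul_sub (φ ψ : G → ℂ) (f : ℂ[G]) :
    pointwiseMul (fun z => φ z - ψ z) f = pointwiseMul φ f - pointwiseMul ψ f := by
  ext z
  simp [sub_mul]

theorem pointwiseMul_eq_self {φ : G → ℂ} {f : ℂ[G]} (h : ∀ z, f.coeff z ≠ 0 → φ z = 1) :
    pointwiseMul φ f = f := by
  ext z
  rw [coeff_pointwiseMul]
  by_cases hz : f.coeff z = 0
  · rw [hz, mul_zero]
  · rw [h z hz, one_mul]

theorem eq_sum_single {f : ℂ[G]} {s : Finset G} (hs : ∀ z, f.coeff z ≠ 0 → z ∈ s) :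
    f = ∑ z ∈ s, f.coeff z • MonoidAlgebra.single z (1 : ℂ) := by
  classical
  ext x
  simp only [MonoidAlgebra.coeff_sum, Finsupp.coe_finsetSum, Finset.sum_apply,
    MonoidAlgebra.coeff_smul_apply, MonoidAlgebra.coeff_single, Finsupp.single_apply, smul_eq_mul,
    mul_ite, mul_one, mul_zero, Finset.sum_ite_eq']
  split_ifs with hx
  · rfl
  · exact not_imp_comm.1 (hs x) hx

variable [Group G]

theorem integrate_apply {H : Type v} [NormedAddCommGroup H] [InnerProductSpace ℂ H]
    [CompleteSpace H] (π : G →* (H ≃ₗᵢ[ℂ] H)) (f : ℂ[G]) (ξ : H) :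
    integrate π f ξ = ∑ z ∈ f.coeff.support, f.coeff z • π z ξ := by
  conv_lhs => rw [eq_sum_single (f := f) fun z hz => Finsupp.mem_support_iff.2 hz]
  simp only [map_sum, map_smul, sum_apply, smul_apply,
    integrate_single, one_smul]

variable [DecidableEq G]

/-- The proportion of elements of `U` that translation by `z` moves into `X`. -/
def cutoff (X U : Finset G) (z : G) : ℂ := ((U.filter fun u => z * u ∈ X).card : ℂ) / U.card

theorem cutoff_eq_one {X U : Finset G} (hU : U.Nonempty) {z : G} (h : ∀ u ∈ U, z * u ∈ X) :
    cutoff X U z = 1 := by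
  rw [cutoff, Finset.filter_true_of_mem h, div_self]
  exact_mod_cast hU.card_ne_zero

theorem cutoff_eq_zero {X U : Finset G} {z : G} (h : ∀ u ∈ U, z * u ∉ X) : cutoff X U z = 0 := by
  rw [cutoff, Finset.filter_false_of_mem h, Finset.card_empty, Nat.cast_zero, zero_div]

/-- Transference: a bound for a block of the matrix of convolution by `f` gives a bound for a
cutoff of `f` in every unitary representation. -/
theorem FormBound.norm_integrate_le {f : ℂ[G]} {X U : Finset G} {K : ℝ} (hK : 0 ≤ K)
    (hU : U.Nonempty) (h : FormBound (fun x u => f.coeff (x * u⁻¹)) X U K)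
    {H : Type v} [NormedAddCommGroup H] [InnerProductSpace ℂ H] [CompleteSpace H]
    (π : G →* (H ≃ₗᵢ[ℂ] H)) :
    ‖integrate π (pointwiseMul (cutoff X U) f)‖ ≤ K * √(X.card / U.card) := by
  have hc : (0 : ℝ) < U.card := by exact_mod_cast hU.card_pos
  refine ContinuousLinearMap.opNorm_le_of_re_inner_le (by positivity) fun ξ η hξ hη => ?_
  -- The form is tested on the orbit vectors `π(u⁻¹)ξ` and `π(x⁻¹)η`: each `z` is counted once for
  -- every `u ∈ U` with `z * u ∈ X`, which produces the cutoff.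
  have key : ∑ x ∈ X, ∑ u ∈ U, f.coeff (x * u⁻¹) * inner ℂ (π x⁻¹ η) (π u⁻¹ ξ) =
      U.card * inner ℂ η (integrate π (pointwiseMul (cutoff X U) f) ξ) := by
    have h1 : ∀ x u, inner ℂ (π x⁻¹ η) (π u⁻¹ ξ) = inner ℂ η (π (x * u⁻¹) ξ) := fun x u => by
      have hmul : ∀ g k ζ, π g (π k ζ) = π (g * k) ζ := fun g k ζ => by rw [map_mul]; rfl
      rw [← (π x).inner_map_map, hmul, hmul, mul_inv_cancel, map_one]
      rfl
    have h2 : integrate π (pointwiseMul (cutoff X U) f) ξ =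
        ∑ z ∈ f.coeff.support, (cutoff X U z * f.coeff z) • π z ξ := by
      rw [integrate_apply]
      refine Finset.sum_subset (fun z hz => ?_) fun z _ hz => ?_
      · rw [Finsupp.mem_support_iff, coeff_pointwiseMul] at hz
        exact Finsupp.mem_support_iff.2 (right_ne_zero_of_mul hz)
      · rw [Finsupp.notMem_support_iff] at hz
        rw [hz, zero_smul]
    have h3 : ∀ u, ∑ x ∈ X, f.coeff (x * u⁻¹) * inner ℂ η (π (x * u⁻¹) ξ) =
        ∑ z ∈ f.coeff.support, if z * u ∈ X then f.coeff z * inner ℂ η (π z ξ) else 0 := by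
      intro u
      rw [← Finset.sum_filter]
      symm
      refine Finset.sum_bij_ne_zero (fun z _ _ => z * u) (fun z hz _ => (Finset.mem_filter.1 hz).2)
        (fun _ _ _ _ _ _ e => mul_right_cancel e) (fun x hx hne => ?_) (fun z _ _ => by simp)
      have hz : f.coeff (x * u⁻¹) ≠ 0 := left_ne_zero_of_mul hne
      exact ⟨x * u⁻¹, Finset.mem_filter.2 ⟨Finsupp.mem_support_iff.2 hz, by simpa using hx⟩, hne,
        by simp⟩
    simp_rw [h1]
    rw [Finset.sum_comm, Finset.sum_congr rfl fun u _ => h3 u, Finset.sum_comm, h2, inner_sum,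
      Finset.mul_sum]
    refine Finset.sum_congr rfl fun z _ => ?_
    have hc' : (U.card : ℂ) ≠ 0 := by exact_mod_cast hc.ne'
    rw [← Finset.sum_filter, Finset.sum_const, nsmul_eq_mul, inner_smul_right, cutoff]
    field_simp
  -- All orbit vectors are unit vectors, so the right side is `K * √|U| * √|X|`; dividing by `|U|`
  -- gives the claim.
  have hb := h.inner_le hK (fun u => π u⁻¹ ξ) fun x => π x⁻¹ η
  simp only [key, LinearIsometryEquiv.norm_map, Finset.sum_const, nsmul_eq_mul] at hb
  rw [hξ, hη, one_pow, mul_one, mul_one, norm_mul, Complex.norm_natCast] at hb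
  refine (RCLike.re_le_norm _).trans ?_
  rw [norm_inner_symm, Real.sqrt_div' _ hc.le]
  refine le_of_mul_le_mul_left (hb.trans_eq ?_) hc
  have hs : √(U.card : ℝ) ≠ 0 := (Real.sqrt_pos.2 hc).ne'
  have hss : (U.card : ℝ) = √(U.card : ℝ) * √(U.card : ℝ) := (Real.mul_self_sqrt hc.le).symm
  generalize √(U.card : ℝ) = s at hs hss ⊢
  rw [hss]
  field_simp

end Cutoff

/-! ### Matrices of convolution operators and commutators -/

section Matrix

theorem seminormLD_apply {G : Type u} [Group G] (𝕃 : LengthFunction G) (f : ℂ[G]) :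
    seminormLD 𝕃 f = ‖commutator 𝕃 f‖ := rfl

variable {G : Type u} [DecidableEq G]

theorem single_mem_mulOp_domain (h : G → ℝ) (u : G) (c : ℂ) :
    (lp.single 2 u c : Ell2 G) ∈ (mulOp h).domain := by
  rw [mem_mulOp_domain]
  refine (congrArg (Memℓp · 2) ?_).mp (lp.single 2 u ((h u : ℂ) * c)).2
  funext x
  by_cases hx : x = u
  · subst hx; simp
  · simp [hx]

theorem ext_single {S T : Ell2 G →L[ℂ] Ell2 G}
    (h : ∀ x u, S (lp.single 2 u 1) x = T (lp.single 2 u 1) x) : S = T := by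
  ext1 ξ
  have hs := lp.hasSum_single (by simp : (2 : ℝ≥0∞) ≠ ⊤) ξ
  refine (hs.mapL S).unique ?_
  convert hs.mapL T using 2 with u
  have : (lp.single 2 u (ξ u) : Ell2 G) = ξ u • lp.single 2 u 1 := by
    rw [← lp.single_smul, smul_eq_mul, mul_one]
  rw [this, map_smul, map_smul]
  congr 1
  ext x
  exact (h x u)

theorem inner_single_one_apply (T : Ell2 G →L[ℂ] Ell2 G) (x u : G) :
    inner ℂ (lp.single 2 x 1 : Ell2 G) (T (lp.single 2 u 1)) = T (lp.single 2 u 1) x := by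
  rw [lp.inner_single_left]
  simp

variable [Group G]

theorem lconv_single_apply (f : ℂ[G]) (x u : G) :
    lconv f (lp.single 2 u 1) x = f.coeff (x * u⁻¹) := by
  have h : ∀ y c, c * (lp.single 2 u (1 : ℂ) : Ell2 G) (y⁻¹ * x) =
      if x * u⁻¹ = y then c else 0 := by
    intro y c
    have : y⁻¹ * x = u ↔ x * u⁻¹ = y := by
      rw [inv_mul_eq_iff_eq_mul, mul_inv_eq_iff_eq_mul]
    rw [lp.single_apply, Pi.single_apply]
    simp only [this, mul_ite, mul_one, mul_zero]
  rw [lconv_apply]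
  simp_rw [h]
  rw [Finsupp.sum_ite_eq]
  split_ifs with hx
  · rfl
  · exact (Finsupp.notMem_support_iff.1 hx).symm

theorem commutator_single_apply (𝕃 : LengthFunction G) (f : ℂ[G]) (x u : G) :
    commutator 𝕃 f (lp.single 2 u 1) x = ((𝕃 x - 𝕃 u : ℝ) : ℂ) * f.coeff (x * u⁻¹) := by
  obtain ⟨h, e⟩ := isCommutator_commutator 𝕃 f ⟨_, single_mem_mulOp_domain 𝕃 u 1⟩
  have hD : dirac 𝕃 ⟨_, single_mem_mulOp_domain 𝕃 u 1⟩ =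
      (𝕃 u : ℂ) • (lp.single 2 u 1 : Ell2 G) := by
    ext x
    rw [mulOp_apply, lp.coeFn_smul, Pi.smul_apply, smul_eq_mul]
    by_cases hx : x = u
    · rw [hx]
    · simp [hx]
  rw [e, hD, map_smul, lp.coeFn_sub, Pi.sub_apply, mulOp_apply, lp.coeFn_smul, Pi.smul_apply,
    smul_eq_mul, lconv_single_apply]
  push_cast
  ring

/-- The factor `𝕃 x - 𝕃 u` is real and antisymmetric in `x` and `u`, whence the sign. -/
theorem commutator_star (𝕃 : LengthFunction G) (f : ℂ[G]) :
    commutator 𝕃 (star f) = -star (commutator 𝕃 f) := by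
  refine ext_single fun x u => ?_
  rw [neg_apply, lp.coeFn_neg, Pi.neg_apply, ← inner_single_one_apply (star _),
    ContinuousLinearMap.star_eq_adjoint, ContinuousLinearMap.adjoint_inner_right,
    ← inner_conj_symm, inner_single_one_apply, commutator_single_apply, commutator_single_apply,
    coeff_star, map_mul, Complex.conj_ofReal, mul_inv_rev, inv_inv, starRingEnd_apply]
  push_cast
  ring

theorem seminormLD_star (𝕃 : LengthFunction G) (f : ℂ[G]) :
    seminormLD 𝕃 (star f) = seminormLD 𝕃 f := by
  rw [seminormLD_apply, seminormLD_apply, commutator_star, norm_neg,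
    ContinuousLinearMap.star_eq_adjoint, LinearIsometryEquiv.norm_map]

theorem seminormLD_one (𝕃 : LengthFunction G) : seminormLD 𝕃 1 = 0 := by
  rw [seminormLD_apply, norm_eq_zero]
  refine ext_single fun x u => ?_
  rw [commutator_single_apply, MonoidAlgebra.one_def, MonoidAlgebra.coeff_single,
    Finsupp.single_apply]
  split_ifs with h
  · rw [eq_comm, mul_inv_eq_one] at h
    simp [h]
  · simp

/-- The commutator sends the unit vector at the identity to `𝕃 · f`. -/
theorem length_mul_norm_coeff_le (𝕃 : LengthFunction G) (f : ℂ[G]) (z : G) :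
    𝕃 z * ‖f.coeff z‖ ≤ seminormLD 𝕃 f := by
  have h1 := lp.norm_apply_le_norm (by simp : (2 : ℝ≥0∞) ≠ 0)
    (commutator 𝕃 f (lp.single 2 1 1)) z
  have h0 : 𝕃 1 = 0 := (𝕃.eq_zero_iff' 1).2 rfl
  rw [commutator_single_apply, h0, sub_zero, inv_one, mul_one, norm_mul, Complex.norm_real,
    Real.norm_eq_abs, abs_of_nonneg (𝕃.nonneg' z)] at h1
  refine h1.trans (((commutator 𝕃 f).le_opNorm _).trans_eq ?_)
  rw [lp.norm_single (by simp), norm_one, mul_one, seminormLD_apply]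

end Matrix

/-! ### Localization under bounded doubling -/

section Doubling

variable {G : Type u} [Group G] {𝕃 : LengthFunction G}

/-- The closed ball of a proper length function as a finset. -/
def LengthFunction.IsProper.finball (hp : 𝕃.IsProper) (r : ℝ) : Finset G := (hp r).toFinset

theorem LengthFunction.IsProper.mem_finball (hp : 𝕃.IsProper) {r : ℝ} {x : G} :
    x ∈ hp.finball r ↔ 𝕃 x ≤ r := by
  simp [finball, LengthFunction.ball]

theorem LengthFunction.IsProper.finball_nonempty (hp : 𝕃.IsProper) {r : ℝ} (hr : 0 ≤ r) :
    (hp.finball r).Nonempty :=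
  ⟨1, hp.mem_finball.2 (((𝕃.eq_zero_iff' 1).2 rfl).trans_le hr)⟩

theorem LengthFunction.BoundedDoubling.card_finball_le (h : 𝕃.BoundedDoubling) :
    ∃ C : ℝ, 1 ≤ C ∧ ∀ (k : ℕ) (r : ℝ), 1 ≤ r →
      ((h.1.finball (2 ^ k * r)).card : ℝ) ≤ C ^ k * (h.1.finball r).card := by
  obtain ⟨C, hC⟩ := h.2
  -- The doubling constant is not assumed nonnegative, and the induction multiplies inequalities by
  -- it.
  refine ⟨max C 1, le_max_right _ _, fun k r hr => ?_⟩
  induction k with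
  | zero => simp
  | succ k ih =>
    have h2 := hC (2 ^ k * r) (one_le_mul_of_one_le_of_one_le (one_le_pow₀ (by norm_num)) hr)
    rw [Set.ncard_eq_toFinset_card _ (h.1 _), Set.ncard_eq_toFinset_card _ (h.1 _)] at h2
    calc ((h.1.finball (2 ^ (k + 1) * r)).card : ℝ)
        = (h.1.finball (2 * (2 ^ k * r))).card := by rw [pow_succ', mul_assoc]
      _ ≤ C * (h.1.finball (2 ^ k * r)).card := h2
      _ ≤ max C 1 * (h.1.finball (2 ^ k * r)).card := by gcongr; exact le_max_left _ _
      _ ≤ max C 1 * (max C 1 ^ k * (h.1.finball r).card) := by gcongr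
      _ = _ := by rw [pow_succ', mul_assoc]

theorem length_le_mul_add (𝕃 : LengthFunction G) (z u : G) : 𝕃 z ≤ 𝕃 (z * u) + 𝕃 u := by
  have := 𝕃.mul_le' (z * u) u⁻¹
  rwa [mul_inv_cancel_right, 𝕃.inv'] at this

variable [DecidableEq G]

/-- The cutoff to the annulus `3R < 𝕃 ≤ 15R`. -/
def annulusCutoff (hp : 𝕃.IsProper) (R : ℝ) : G → ℂ :=
  cutoff (hp.finball (2 ^ 4 * R) \ hp.finball (2 * R)) (hp.finball R)

/-- The cutoff to the ball `𝕃 ≤ 3R`. -/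
def ballCutoff (hp : 𝕃.IsProper) (R : ℝ) : G → ℂ :=
  cutoff (hp.finball (2 ^ 2 * R)) (hp.finball R)

/-- Right multiplication by `u ∈ B(R)` changes the length by at most `R`, so `z * u` stays in `2R <
𝕃 ≤ 16R`. -/
theorem annulusCutoff_eq_one (hp : 𝕃.IsProper) {R : ℝ} (hR : 0 < R) {z : G} (h1 : 3 * R < 𝕃 z)
    (h2 : 𝕃 z ≤ 15 * R) : annulusCutoff hp R z = 1 := by
  refine cutoff_eq_one (hp.finball_nonempty hR.le) fun u hu => ?_
  rw [hp.mem_finball] at hu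
  rw [Finset.mem_sdiff, hp.mem_finball, hp.mem_finball, not_le]
  constructor <;> linarith [𝕃.mul_le' z u, length_le_mul_add 𝕃 z u]

theorem ballCutoff_eq_one (hp : 𝕃.IsProper) {R : ℝ} (hR : 0 < R) {z : G} (h : 𝕃 z ≤ 3 * R) :
    ballCutoff hp R z = 1 := by
  refine cutoff_eq_one (hp.finball_nonempty hR.le) fun u hu => ?_
  rw [hp.mem_finball] at hu ⊢
  linarith [𝕃.mul_le' z u]

theorem ballCutoff_eq_zero (hp : 𝕃.IsProper) {R : ℝ} {z : G} (h : 5 * R < 𝕃 z) :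
    ballCutoff hp R z = 0 := by
  refine cutoff_eq_zero fun u hu => ?_
  rw [hp.mem_finball] at hu ⊢
  linarith [length_le_mul_add 𝕃 z u]

variable {H : Type v} [NormedAddCommGroup H] [InnerProductSpace ℂ H] [CompleteSpace H]

/-- The commutator estimate on the block, followed by transference to the regular representation; `C
^ 2` is the square root of the volume ratio `C ^ 4`. -/
theorem norm_lconv_annulus_le (hp : 𝕃.IsProper) {R C : ℝ} (hR : 0 < R)
    (hcard : ((hp.finball (2 ^ 4 * R)).card : ℝ) ≤ C ^ 4 * (hp.finball R).card) (f : ℂ[G]) :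
    ‖lconv (pointwiseMul (annulusCutoff hp R) f)‖ ≤ C ^ 2 * (seminormLD 𝕃 f / R) := by
  have hU := hp.finball_nonempty hR.le
  have hc : (0 : ℝ) < (hp.finball R).card := by exact_mod_cast hU.card_pos
  have hform := formBound_of_commutator (X := hp.finball (2 ^ 4 * R) \ hp.finball (2 * R))
    (U := hp.finball R) hR (fun u _ => 𝕃.nonneg' u) (fun u hu => hp.mem_finball.1 hu)
    (fun x hx => (not_le.1 (mt hp.mem_finball.2 (Finset.mem_sdiff.1 hx).2)).le)
    (norm_nonneg (commutator 𝕃 f)) (norm_nonneg _)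
    (formBound_of_hasMatrix (lconv_single_apply f) _ _)
    (formBound_of_hasMatrix (commutator_single_apply 𝕃 f) _ _)
  refine (hform.norm_integrate_le (by positivity) hU (leftRegular G)).trans ?_
  rw [mul_comm, seminormLD_apply]
  refine mul_le_mul_of_nonneg_right ?_ (by positivity)
  rw [Real.sqrt_le_left (by positivity), div_le_iff₀ hc, ← pow_mul]
  exact le_trans (by exact_mod_cast Finset.card_le_card Finset.sdiff_subset) hcard

/-- Transference of the trivial bound `‖lconv f‖`. It compares an arbitrary unitary representation
with the regular one, at a cost independent of `R`. -/
theorem norm_integrate_ballCutoff_le (hp : 𝕃.IsProper) {R C : ℝ} (hR : 0 < R) (hC : 0 ≤ C)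
    (hcard : ((hp.finball (2 ^ 2 * R)).card : ℝ) ≤ C ^ 2 * (hp.finball R).card)
    (π : G →* (H ≃ₗᵢ[ℂ] H)) (f : ℂ[G]) :
    ‖integrate π (pointwiseMul (ballCutoff hp R) f)‖ ≤ C * ‖lconv f‖ := by
  have hU := hp.finball_nonempty hR.le
  have hc : (0 : ℝ) < (hp.finball R).card := by exact_mod_cast hU.card_pos
  have hform := formBound_of_hasMatrix (lconv_single_apply f) (hp.finball (2 ^ 2 * R))
    (hp.finball R)
  refine (hform.norm_integrate_le (norm_nonneg _) hU π).trans ?_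
  rw [mul_comm]
  refine mul_le_mul_of_nonneg_right ?_ (norm_nonneg _)
  rw [Real.sqrt_le_left hC, div_le_iff₀ hc]
  exact hcard

/-- In every unitary representation, the part of `f` at distance at least `R` from the identity has
norm `O(L_D(f) / R)`. -/
theorem norm_integrate_sub_ballCutoff_le (h : 𝕃.BoundedDoubling) : ∃ K : ℝ, ∀ (n : ℕ)
    {H : Type v} [NormedAddCommGroup H] [InnerProductSpace ℂ H] [CompleteSpace H]
    (π : G →* (H ≃ₗᵢ[ℂ] H)) (f : ℂ[G]),
    ‖integrate π (f - pointwiseMul (ballCutoff h.1 (2 ^ n)) f)‖ ≤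
      K * seminormLD 𝕃 f * (1 / 2) ^ n := by
  obtain ⟨C, hC1, hC⟩ := h.card_finball_le
  have hC0 : 0 ≤ C := zero_le_one.trans hC1
  have hp := h.1
  refine ⟨4 * C ^ 3, fun n H _ _ _ π f => ?_⟩
  have hpow : ∀ k : ℕ, (1 : ℝ) ≤ 2 ^ k := fun k => one_le_pow₀ (by norm_num)
  have hpos : ∀ k : ℕ, (0 : ℝ) < 2 ^ k := fun k => by positivity
  have hL : 0 ≤ seminormLD 𝕃 f := apply_nonneg _ _
  set φ : ℕ → G → ℂ := fun k => ballCutoff hp (2 ^ k) with hφ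
  have step : ∀ k, ‖integrate π (pointwiseMul (φ (k + 1)) f - pointwiseMul (φ k) f)‖ ≤
      2 * C ^ 3 * seminormLD 𝕃 f * (1 / 2) ^ k := by
    intro k
    set g := pointwiseMul (annulusCutoff hp (2 ^ k)) f with hg
    -- Consecutive cutoffs agree for `𝕃 z ≤ 3 * 2 ^ k` (both are 1) and for `𝕃 z > 10 * 2 ^ k` (both
    -- are 0). In between the annulus cutoff is 1, so `f` may be replaced by `g`, whose regular norm
    -- is small.
    have e : pointwiseMul (φ (k + 1)) f - pointwiseMul (φ k) f =
        pointwiseMul (φ (k + 1)) g - pointwiseMul (φ k) g := by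
      rw [← pointwiseMul_sub, ← pointwiseMul_sub]
      ext z
      simp only [coeff_pointwiseMul, hg, hφ]
      have hk := hpos k
      have hk' : (2 : ℝ) ^ (k + 1) = 2 * 2 ^ k := pow_succ' _ _
      rcases le_or_gt (𝕃 z) (3 * 2 ^ k) with h1 | h1
      · rw [ballCutoff_eq_one hp (hpos _) h1, ballCutoff_eq_one hp (hpos _) (by linarith)]
        simp
      rcases le_or_gt (𝕃 z) (15 * 2 ^ k) with h2 | h2
      · rw [annulusCutoff_eq_one hp hk h1 h2, one_mul]
      · rw [ballCutoff_eq_zero hp (by linarith), ballCutoff_eq_zero hp (by linarith)]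
        simp
    have h1 := norm_integrate_ballCutoff_le hp (hpos (k + 1)) hC0 (hC 2 _ (hpow _)) π g
    have h2 := norm_integrate_ballCutoff_le hp (hpos k) hC0 (hC 2 _ (hpow _)) π g
    have h3 := norm_lconv_annulus_le hp (hpos k) (hC 4 _ (hpow _)) f
    rw [e, map_sub]
    calc _ ≤ C * ‖lconv g‖ + C * ‖lconv g‖ := (norm_sub_le _ _).trans (add_le_add h1 h2)
      _ ≤ C * (C ^ 2 * (seminormLD 𝕃 f / 2 ^ k)) + C * (C ^ 2 * (seminormLD 𝕃 f / 2 ^ k)) := by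
        gcongr
      _ = _ := by rw [one_div, inv_pow]; ring
  have tele : ∀ N, n ≤ N → ‖integrate π (pointwiseMul (φ N) f - pointwiseMul (φ n) f)‖ ≤
      4 * C ^ 3 * seminormLD 𝕃 f * ((1 / 2) ^ n - (1 / 2) ^ N) := by
    intro N hN
    induction N, hN using Nat.le_induction with
    | base => simp
    | succ N _ ih =>
      rw [← sub_add_sub_cancel, map_add]
      refine (norm_add_le _ _).trans ((add_le_add (step N) ih).trans_eq ?_)
      rw [pow_succ]
      ring
  -- Finite support makes the telescoping sum finite, with a bound independent of `N`.
  obtain ⟨N, hnN, hN⟩ : ∃ N, n ≤ N ∧ pointwiseMul (φ N) f = f := by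
    obtain ⟨M, hM⟩ := (f.coeff.support.image 𝕃).exists_le
    obtain ⟨N, hN⟩ := pow_unbounded_of_one_lt M (one_lt_two : (1 : ℝ) < 2)
    refine ⟨max n N, le_max_left _ _, pointwiseMul_eq_self fun z hz => ?_⟩
    have h1 := hM _ (Finset.mem_image_of_mem _ (Finsupp.mem_support_iff.2 hz))
    have h2 : (2 : ℝ) ^ N ≤ 2 ^ max n N := pow_le_pow_right₀ one_le_two (le_max_right _ _)
    exact ballCutoff_eq_one hp (hpos _) (by linarith [hpos (max n N)])
  have hfin := tele N hnN
  rw [hN] at hfin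
  refine hfin.trans (mul_le_mul_of_nonneg_left ?_ (by positivity))
  have : (0 : ℝ) ≤ (1 / 2) ^ N := by positivity
  linarith

end Doubling

/-! ### The Lip-norm property -/

section LipNorm

variable {G : Type u} [Group G] {𝕃 : LengthFunction G}
variable {H : Type v} [NormedAddCommGroup H] [InnerProductSpace ℂ H] [CompleteSpace H]

theorem denseRange_toCstarOf (π : G →* (H ≃ₗᵢ[ℂ] H)) : DenseRange (toCstarOf π) := by
  intro a
  rw [Topology.IsInducing.subtypeVal.closure_eq_preimage_closure_image, ← Set.range_comp]
  exact a.2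

theorem norm_coeff_le_of_length_pos (𝕃 : LengthFunction G) [DecidableEq G] {f : ℂ[G]}
    (hf : seminormLD 𝕃 f ≤ 1) {z : G} (hz : z ≠ 1) : ‖f.coeff z‖ ≤ (𝕃 z)⁻¹ := by
  have h1 := length_mul_norm_coeff_le 𝕃 f z
  have h0 : 0 < 𝕃 z := (𝕃.nonneg' z).lt_of_ne' fun e => hz ((𝕃.eq_zero_iff' z).1 e)
  rw [← one_div, le_div_iff₀ h0]
  linarith

/-- Under bounded doubling, `L_D` is a Lip-norm on the C*-algebra generated by any unitary
representation that is faithful on `c_c(G)`. -/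
theorem isLipNorm_toCstarOf (h : 𝕃.BoundedDoubling) (π : G →* (H ≃ₗᵢ[ℂ] H))
    (hπ : Function.Injective (integrate π)) : IsLipNorm (toCstarOf π) (seminormLD 𝕃) := by
  classical
  refine ⟨fun f g e => hπ (congrArg Subtype.val e), denseRange_toCstarOf π, seminormLD_star 𝕃,
    seminormLD_one 𝕃, connesMetric_topology_eq _ _ (denseRange_toCstarOf π) fun ε hε => ?_⟩
  obtain ⟨K, hK⟩ := norm_integrate_sub_ballCutoff_le.{u, v} h
  -- The 4 is two states times the factor 2 of `norm_state_apply_le`.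
  obtain ⟨n, hn⟩ : ∃ n : ℕ, 4 * (max K 0 * (1 / 2) ^ n) < ε := by
    have := ((tendsto_pow_atTop_nhds_zero_of_lt_one (r := (1 / 2 : ℝ)) (by norm_num)
      (by norm_num)).const_mul (max K 0)).const_mul 4
    rw [mul_zero, mul_zero] at this
    exact (this.eventually_lt_const hε).exists
  set φ := ballCutoff h.1 ((2 : ℝ) ^ n) with hφ
  set S := h.1.finball (5 * 2 ^ n) with hS
  have hφS : ∀ z, φ z ≠ 0 → z ∈ S := fun z hz => by
    by_contra hzS
    rw [hS, h.1.mem_finball, not_le] at hzS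
    exact hz (ballCutoff_eq_zero h.1 hzS)
  -- The term at the identity is 0, since `0⁻¹ = 0`. The sum serves only as a common upper bound for
  -- its terms.
  set M : ℝ := ∑ z ∈ S, ‖φ z‖ * (𝕃 z)⁻¹ with hM
  have hMz : ∀ z ∈ S, ‖φ z‖ * (𝕃 z)⁻¹ ≤ M := fun z hz =>
    Finset.single_le_sum (f := fun z => ‖φ z‖ * (𝕃 z)⁻¹)
      (fun z _ => mul_nonneg (norm_nonneg _) (inv_nonneg.2 (𝕃.nonneg' z))) hz
  have hinj : Function.Injective fun z : G => (MonoidAlgebra.single z (1 : ℂ) : ℂ[G]) :=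
    MonoidAlgebra.single_left_injective one_ne_zero
  refine ⟨S.map ⟨_, hinj⟩, M, fun f hf μ ν => ?_⟩
  set g := pointwiseMul φ f with hg
  have hfg : ‖toCstarOf π (f - g)‖ ≤ max K 0 * (1 / 2) ^ n := by
    refine (hK n π f).trans (mul_le_mul_of_nonneg_right ?_ (by positivity))
    calc K * seminormLD 𝕃 f ≤ max K 0 * seminormLD 𝕃 f :=
          mul_le_mul_of_nonneg_right (le_max_left _ _) (apply_nonneg _ _)
      _ ≤ max K 0 * 1 := mul_le_mul_of_nonneg_left hf (le_max_right _ _)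
      _ = _ := mul_one _
  have hgsum : ‖μ.1 (toCstarOf π g) - ν.1 (toCstarOf π g)‖ ≤
      M * ∑ z ∈ S, ‖μ.1 (toCstarOf π (.single z 1)) - ν.1 (toCstarOf π (.single z 1))‖ := by
    have e : g = ∑ z ∈ S, g.coeff z • MonoidAlgebra.single z (1 : ℂ) :=
      eq_sum_single fun z hz => hφS z (left_ne_zero_of_mul hz)
    rw [e]
    simp only [map_sum, map_smul]
    rw [← Finset.sum_sub_distrib, Finset.mul_sum]
    refine (norm_sum_le _ _).trans (Finset.sum_le_sum fun z hz => ?_)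
    rw [← smul_sub, norm_smul]
    -- `L_D` does not bound the coefficient at the identity, but both states are 1 there.
    by_cases hz1 : z = 1
    · have : toCstarOf π (MonoidAlgebra.single z 1) = 1 := by
        rw [hz1, ← MonoidAlgebra.one_def, map_one]
      rw [this, μ.2.1, ν.2.1]
      simp
    · refine mul_le_mul_of_nonneg_right ?_ (norm_nonneg _)
      rw [hg, coeff_pointwiseMul, norm_mul]
      exact (mul_le_mul_of_nonneg_left (norm_coeff_le_of_length_pos 𝕃 hf hz1)
        (norm_nonneg _)).trans (hMz z hz)
  have h1 := norm_state_apply_le μ.2 (toCstarOf π (f - g))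
  have h2 := norm_state_apply_le ν.2 (toCstarOf π (f - g))
  rw [map_sub, map_sub] at h1 h2
  rw [Finset.sum_map]
  have e : μ.1 (toCstarOf π f) - ν.1 (toCstarOf π f) =
      (μ.1 (toCstarOf π f) - μ.1 (toCstarOf π g)) - (ν.1 (toCstarOf π f) - ν.1 (toCstarOf π g)) +
        (μ.1 (toCstarOf π g) - ν.1 (toCstarOf π g)) := by ring
  rw [e]
  refine (norm_add_le _ _).trans (add_le_add ((norm_sub_le _ _).trans ?_) hgsum)
  rw [map_sub] at hfg
  linarith

variable (G) in
-- `λ_f` sends the unit vector at the identity to `f`.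
theorem injective_lconv : Function.Injective (lconv : ℂ[G] → _) := by
  classical
  intro f g e
  ext z
  have := lconv_single_apply f z 1
  rw [e, lconv_single_apply] at this
  simpa using this.symm

variable (G) in
theorem injective_integrate_universalRep : Function.Injective (integrate (universalRep G)) := by
  classical
  intro f g e
  refine injective_lconv G (ContinuousLinearMap.ext fun ξ => ?_)
  -- The regular representation is a summand of the universal one and is already faithful on
  -- `c_c(G)`.
  let σ : UnitaryRep G := ⟨Ell2 G, leftRegular G⟩
  have hσ : ∀ f : ℂ[G], integrate (universalRep G) f (lp.single 2 σ ξ) σ = lconv f ξ := by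
    intro f
    rw [integrate_apply, lconv, integrate_apply, lp.coeFn_sum, Finset.sum_apply]
    refine Finset.sum_congr rfl fun z _ => ?_
    rw [lp.coeFn_smul, Pi.smul_apply]
    change f.coeff z • σ.rep z ((lp.single 2 σ ξ : UniversalSpace G) σ) = _
    rw [lp.single_apply_self]
  rw [← hσ, ← hσ, e]

end LipNorm

end GroupCStar

end

theorem theorem1p4 {G : Type*} [Group G] (𝕃 : GroupCStar.LengthFunction G)
    (h𝕃 : 𝕃.BoundedDoubling) :
    GroupCStar.IsLipNorm
        (GroupCStar.toCstarOf (GroupCStar.leftRegular G) : _ →⋆ₐ[ℂ] GroupCStar.ReducedCStar G)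
        (GroupCStar.seminormLD 𝕃) ∧
      GroupCStar.IsLipNorm
        (GroupCStar.toCstarOf (GroupCStar.universalRep G) : _ →⋆ₐ[ℂ] GroupCStar.FullCStar G)
        (GroupCStar.seminormLD 𝕃) :=
  ⟨GroupCStar.isLipNorm_toCstarOf h𝕃 _ (GroupCStar.injective_lconv G),
    GroupCStar.isLipNorm_toCstarOf h𝕃 _ (GroupCStar.injective_integrate_universalRep G)⟩
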